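/- Let $G=(V,E)$ be a finite simple graph, $n=|V|$. For $c\in\mathbb R^{E}$ let $F(G,c)$ be the set of real positive semidefinite $V\times V$ matrices $X$ with $X[i,i]=1$ for all $i\in V$ and $X[i,j]=c(ij)$ for all $ij\in E$ (the feasible set of the PSD matrix completion problem $\mathrm P(G,c)$), and let $\mathcal E(G)=\{c\in\mathbb R^E\mid F(G,c)\neq\emptyset\}$. For $\omega\in\mathbb R^{V\cup E}$ put $\Omega=\sum_{i\in V}\omega(i)E_{ii}+\sum_{ij\in E}\omega(ij)E_{ij}$, where $E_{ij}=(e_ie_j^{\top}+e_je_i^{\top})/2$. For $c\in\mathcal E(G)$, the singularity degree $\mathsf{sd}(G,c)$ is the smallest $k\ge 0$ for which there are $\omega^1,\dots,\omega^k\in\mathbb R^{V\cup E}$ such that, with $\mathcal V^j=\{x\in\mathbb R^V\mid x^{\top}\Omega^i x=0\ (1\le i\le j)\}$ (so $\mathcal V^0=\mathbb R^V$): 1. $x^{\top}\Omega^j x\ge 0$ for all $x\in\mathcal V^{j-1}$, $1\le j\le k$ (under this condition every $\mathcal V^j$ is a linear subspace); 2. $\sum_{i\in V}\omega^j(i)+\sum_{ij\in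 E}\omega^j(ij)c(ij)\le 0$ for $1\le j\le k$; 3. $\dim\mathcal V^k$ equals the rank of a relative interior point of $F(G,c)$. In particular $\mathsf{sd}(G,c)=0$ if and only if $F(G,c)$ contains a positive definite matrix. Let $\mathsf{sd}(G)=\max\{\mathsf{sd}(G,c)\mid c\in\mathcal E(G)\}$. The graph $G$ is chordal if it has no induced cycle of length at least four. Theorem. For every finite simple graph $G$, $\mathsf{sd}(G)\le 1$ if and only if $G$ is chordal. -/

import Mathlib

/-!  The positive semidefinite matrix completion problem P(G, c) of a finite simple graph `G`
with edge weights `c` (unit diagonal), its facial reduction, and the singularity degree. -/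

namespace PSDCompletion

/-- The feasible set of P(G, c): real positive semidefinite matrices `X` with unit diagonal and
`X[i,j] = c(ij)` for every edge `ij`. -/
def feasibleSet {V : Type*} (G : SimpleGraph V) (c : G.edgeSet → ℝ) : Set (Matrix V V ℝ) :=
  {X | X.PosSemidef ∧ (∀ i, X i i = 1) ∧ ∀ i j (h : G.Adj i j), X i j = c ⟨s(i, j), h⟩}

/-- The set `ℰ(G)` of edge weights for which P(G, c) is feasible, i.e. the coordinate
projection of the elliptope (the unit-diagonal positive semidefinite matrices). -/
def feasibleWeights {V : Type*} (G : SimpleGraph V) : Set (G.edgeSet → ℝ) :=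
  {c | (feasibleSet G c).Nonempty}

open Classical in
/-- For dual variables `ω ∈ ℝ^{V ∪ E}`, the matrix
`Ω = ∑_{i ∈ V} ω(i) E_ii + ∑_{ij ∈ E} ω(ij) E_ij` with `E_ij = (e_i e_jᵀ + e_j e_iᵀ) / 2`,
given entrywise. -/
noncomputable def stressMatrix {V : Type*} (G : SimpleGraph V) (ω : V ⊕ G.edgeSet → ℝ) :
    Matrix V V ℝ :=
  Matrix.of fun i j =>
    if i = j then ω (Sum.inl i)
    else if h : G.Adj i j then ω (Sum.inr ⟨s(i, j), h⟩) / 2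
    else 0

open Classical in
/-- The objective value `∑_{i ∈ V} ω(i) + ∑_{ij ∈ E} ω(ij) c(ij)` of the dual problem. -/
noncomputable def dualValue {V : Type*} [Fintype V] (G : SimpleGraph V) (c : G.edgeSet → ℝ)
    (ω : V ⊕ G.edgeSet → ℝ) : ℝ :=
  ∑ i, ω (Sum.inl i) + ∑ e : G.edgeSet, ω (Sum.inr e) * c e

/-- `𝒱ʲ = {x ∈ ℝ^V | xᵀ Yⁱ x = 0 for the first j matrices Yⁱ of the sequence}`;
in particular `𝒱⁰ = ℝ^V`. -/
def nullCone {V : Type*} [Fintype V] {k : ℕ} (Y : Fin k → Matrix V V ℝ) (j : ℕ) :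
    Set (V → ℝ) :=
  {x | ∀ i : Fin k, (i : ℕ) < j → x ⬝ᵥ (Y i).mulVec x = 0}

/-- A sequence of symmetric matrices is nested PSD if each matrix is positive semidefinite on the
space `𝒱` cut out by its predecessors. -/
def IsNestedPSD {V : Type*} [Fintype V] {k : ℕ} (Y : Fin k → Matrix V V ℝ) : Prop :=
  ∀ j : Fin k, (Y j).IsSymm ∧ ∀ x ∈ nullCone Y j, 0 ≤ x ⬝ᵥ (Y j).mulVec x

/-- A (complete) facial reduction sequence of length `k` for P(G, c): dual vectors
`ω¹, …, ωᵏ` such that `Ω¹, …, Ωᵏ` is nested PSD, each dual value is nonpositive, and the dimension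
of the final space `𝒱ᵏ` is the rank of a (relative) interior point of the feasible set.  There is
no sign condition on the `ωʲ`, since all linear constraints of P(G, c) are equations.
The set `𝒱ᵏ` of a nested PSD sequence is a linear subspace, so `Set.finrank` is its dimension.
For `k = 0` the conditions say that an interior point is positive definite. -/
def IsFacialReduction {V : Type*} [Fintype V] (G : SimpleGraph V) (c : G.edgeSet → ℝ) {k : ℕ}
    (ω : Fin k → V ⊕ G.edgeSet → ℝ) : Prop :=
  IsNestedPSD (fun j => stressMatrix G (ω j)) ∧
  (∀ j, dualValue G c (ω j) ≤ 0) ∧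
  ∃ X ∈ intrinsicInterior ℝ (feasibleSet G c),
    (nullCone (fun j => stressMatrix G (ω j)) k).finrank ℝ = X.rank

/-- The singularity degree `sd(G, c)` of P(G, c): the smallest length of a facial reduction
sequence (`⊤` if there were none, which does not happen for feasible problems). -/
noncomputable def weightSingularityDegree {V : Type*} [Fintype V] (G : SimpleGraph V)
    (c : G.edgeSet → ℝ) : ℕ∞ :=
  ⨅ (k : ℕ) (_ : ∃ ω : Fin k → V ⊕ G.edgeSet → ℝ, IsFacialReduction G c ω), (k : ℕ∞)

/-- The singularity degree `sd(G)`: the largest `sd(G, c)` over all `c ∈ ℰ(G)`. -/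
noncomputable def singularityDegree {V : Type*} [Fintype V] (G : SimpleGraph V) : ℕ∞ :=
  ⨆ c ∈ feasibleWeights G, weightSingularityDegree G c

/-- A graph is chordal if it has no hole, i.e. no induced cycle of length at least four. -/
def IsChordal {V : Type*} (G : SimpleGraph V) : Prop :=
  ∀ n : ℕ, 4 ≤ n → IsEmpty (SimpleGraph.cycleGraph n ↪g G)

end PSDCompletion

namespace PSDCompletion

/-! ### Chordal graphs: simplicial vertices -/

section Graph

open SimpleGraph

/-! A feasible `X` pairs with a stress matrix `Ω` to give its dual value, so a positive semidefinite
`Ω` of nonpositive dual value annihilates the range of every feasible matrix. One step of facial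
reduction suffices exactly when some such `Ω` has the range of a relative interior point `Z` as its
whole kernel.

If `G` is chordal, adding simplicial vertices one at a time yields a feasible `X` whose kernel is
spanned by vectors `w` supported on cliques (`IsChordal.exists_completion`). Then `Ω = ∑ w wᵀ` is a
stress matrix and `ker Ω = (ker X)ᗮ ⊆ (ker Z)ᗮ = range Z ⊆ ker Ω`.

If `G` has a hole, place unit vectors `a, a, a + b, b, …, b` along it, with `a`, `b` at 120 degrees,
and new orthonormal vectors elsewhere. Every completion has `e₀ + e₃ - e₂` in its kernel, so `e₂` is
not in its range. Yet every admissible first `Ω` annihilates `e₂`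
(`stressMatrix_mulVec_single_eq_zero`), because the edge pattern of the hole leaves it too few
entries. So one step is not enough. -/

theorem cycleGraph_adj_iff_val {n : ℕ} (hn : 2 ≤ n) (u v : Fin n) :
    (cycleGraph n).Adj u v ↔ u.val + 1 = v.val ∨ v.val + 1 = u.val ∨
      (u.val = 0 ∧ v.val + 1 = n) ∨ (v.val = 0 ∧ u.val + 1 = n) := by
  have key : ∀ a b : Fin n, (a - b).val = 1 ↔ b.val + 1 = a.val ∨ (a.val = 0 ∧ b.val + 1 = n) := by
    intro a b
    have ha := a.isLt
    have hb := b.isLt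
    rw [Fin.sub_def]
    simp only
    rcases le_or_gt b.val a.val with h | h
    · rw [show n - b.val + a.val = (a.val - b.val) + n by omega, Nat.add_mod_right,
        Nat.mod_eq_of_lt (by omega)]
      omega
    · rw [Nat.mod_eq_of_lt (by omega)]
      omega
  rw [cycleGraph_adj', key, key]
  tauto

variable {V : Type*} {G : SimpleGraph V}

/-- A chordless path of length at least two, closed up by a vertex that sees exactly its two ends,
is a hole. -/
theorem not_isChordal_of_chordless_path {m : ℕ} (hm : 2 ≤ m) (p : ℕ → V) (t : V)
    (hadj : ∀ i < m, G.Adj (p i) (p (i + 1)))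
    (hfar : ∀ i j, i + 2 ≤ j → j ≤ m → p i ≠ p j ∧ ¬ G.Adj (p i) (p j))
    (hfst : G.Adj t (p 0)) (hlst : G.Adj t (p m))
    (hint : ∀ i, 0 < i → i < m → t ≠ p i ∧ ¬ G.Adj t (p i)) : ¬ IsChordal G := by
  intro hG
  have ht : ∀ i, i ≤ m → (G.Adj t (p i) ↔ i = 0 ∨ i = m) ∧ t ≠ p i := by
    intro i hi
    rcases Nat.eq_zero_or_pos i with rfl | h0
    · exact ⟨by simp [hfst], hfst.ne⟩
    · rcases hi.eq_or_lt with rfl | h1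
      · exact ⟨by simp [hlst], hlst.ne⟩
      · exact ⟨⟨fun h => absurd h (hint i h0 h1).2, fun h => by omega⟩, (hint i h0 h1).1⟩
  have hp : ∀ i j, i < j → j ≤ m → (G.Adj (p i) (p j) ↔ j = i + 1) ∧ p i ≠ p j := by
    intro i j hij hj
    by_cases h : j = i + 1
    · subst h
      exact ⟨by simp [hadj i (by omega)], (hadj i (by omega)).ne⟩
    · have := hfar i j (by omega) hj
      exact ⟨⟨fun h' => absurd h' this.2, fun h' => absurd h' h⟩, this.1⟩
  -- The path followed by `t` at index `m + 1` is the hole, of length `m + 2`.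
  let f : ℕ → V := fun i => if i = m + 1 then t else p i
  have hf : ∀ i j, i < j → j < m + 2 →
      (G.Adj (f i) (f j) ↔ j = i + 1 ∨ (i = 0 ∧ j = m + 1)) ∧ f i ≠ f j := by
    intro i j hij hj
    simp only [f, if_neg (show i ≠ m + 1 by omega)]
    split_ifs with h
    · have := ht i (by omega)
      refine ⟨?_, this.2.symm⟩
      rw [G.adj_comm, this.1]
      omega
    · have := hp i j hij (by omega)
      refine ⟨?_, this.2⟩
      rw [this.1]
      omega
  refine (hG (m + 2) (by omega)).false ⟨⟨fun i => f i.val, ?_⟩, ?_⟩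
  · intro i j hij
    by_contra hne
    have : i.val ≠ j.val := fun h => hne (Fin.ext h)
    rcases this.lt_or_gt with h | h
    · exact (hf _ _ h j.isLt).2 hij
    · exact (hf _ _ h i.isLt).2 hij.symm
  · intro i j
    change G.Adj (f i.val) (f j.val) ↔ _
    rw [cycleGraph_adj_iff_val (by omega)]
    have hi := i.isLt
    have hj := j.isLt
    rcases lt_trichotomy i.val j.val with h | h | h
    · rw [(hf _ _ h j.isLt).1]
      omega
    · rw [h]
      simp only [SimpleGraph.irrefl, false_iff]
      omega
    · rw [G.adj_comm, (hf _ _ h i.isLt).1]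
      omega

/-- The edges of `G` inside a set of vertices, as a graph on all vertices. -/
def restrictEdges (G : SimpleGraph V) (D : Set V) : SimpleGraph V where
  Adj a b := G.Adj a b ∧ a ∈ D ∧ b ∈ D
  symm := ⟨fun _ _ h => ⟨h.1.symm, h.2.2, h.2.1⟩⟩
  loopless := ⟨fun _ h => h.1.ne rfl⟩

theorem restrictEdges_mono {D D' : Set V} (h : D ⊆ D') :
    restrictEdges G D ≤ restrictEdges G D' :=
  fun _ _ hab => ⟨hab.1, h hab.2.1, h hab.2.2⟩

theorem mem_of_reachable_restrictEdges {D : Set V} {a b : V} (ha : a ∈ D)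
    (h : (restrictEdges G D).Reachable a b) : b ∈ D := by
  obtain ⟨w⟩ := h
  induction w with
  | nil => exact ha
  | cons h _ ih => exact ih h.2.2

/-- In a chordal graph, two neighbours of `t` joined by a path whose interior avoids the closed
neighbourhood of `t` are adjacent. -/
theorem IsChordal.adj_of_reachable (hG : IsChordal G) {D : Set V} {t x y : V} (hxy : x ≠ y)
    (htx : G.Adj t x) (hty : G.Adj t y) (hD : ∀ d ∈ D, d ≠ t ∧ ¬ G.Adj t d)
    (hr : (restrictEdges G (D ∪ {x, y})).Reachable x y) : G.Adj x y := by
  by_contra hnadj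
  set H := restrictEdges G (D ∪ {x, y})
  -- A shortest walk has its `i`-th vertex at distance `i` from `x`; hence it has no repetitions and
  -- no chords.
  obtain ⟨w, hw⟩ := hr.exists_walk_length_eq_dist
  have hm0 : 0 < w.length := by
    rw [hw]
    exact hr.pos_dist_of_ne hxy
  have hstep : ∀ i < w.length, H.Adj (w.getVert i) (w.getVert (i + 1)) :=
    fun i hi => w.adj_getVert_succ hi
  have hmem : ∀ i ≤ w.length, w.getVert i ∈ D ∪ {x, y} := fun i _ =>
    mem_of_reachable_restrictEdges (by simp) ⟨w.take i⟩
  have hdist : ∀ i ≤ w.length, H.dist x (w.getVert i) = i := by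
    intro i hi
    have h1 : H.dist x (w.getVert i) ≤ i :=
      (dist_le (w.take i)).trans (by rw [Walk.take_length]; omega)
    have h2 : H.dist (w.getVert i) y ≤ w.length - i :=
      (dist_le (w.drop i)).trans (by rw [Walk.drop_length])
    have h3 : H.dist x y ≤ H.dist x (w.getVert i) + H.dist (w.getVert i) y := by
      obtain ⟨u, hu⟩ := (show H.Reachable x (w.getVert i) from ⟨w.take i⟩).exists_walk_length_eq_dist
      obtain ⟨v, hv⟩ := (show H.Reachable (w.getVert i) y from ⟨w.drop i⟩).exists_walk_length_eq_dist
      rw [← hu, ← hv, ← Walk.length_append]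
      exact dist_le _
    omega
  have hinj : ∀ i j, i ≤ w.length → j ≤ w.length → w.getVert i = w.getVert j → i = j := by
    intro i j hi hj h
    rw [← hdist i hi, ← hdist j hj, h]
  have hm2 : 2 ≤ w.length := by
    by_contra h
    have h1 := hstep 0 hm0
    have : w.length = 1 := by omega
    rw [Walk.getVert_zero, zero_add, ← this, Walk.getVert_length] at h1
    exact hnadj h1.1
  refine not_isChordal_of_chordless_path hm2 w.getVert t (fun i hi => (hstep i hi).1) ?_
    (by simpa using htx) (by simpa using hty) ?_ hG
  · intro i j hij hj
    refine ⟨fun h => by have := hinj i j (by omega) hj h; omega, fun h => ?_⟩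
    have hadj : H.Adj (w.getVert i) (w.getVert j) := ⟨h, hmem i (by omega), hmem j hj⟩
    obtain ⟨u, hu⟩ := (show H.Reachable x (w.getVert i) from ⟨w.take i⟩).exists_walk_length_eq_dist
    have := dist_le (u.concat hadj)
    rw [Walk.length_concat, hu, hdist i (by omega), hdist j hj] at this
    omega
  · intro i h0 hi
    have hx : w.getVert i ≠ x := fun h => by
      have := hinj i 0 hi.le (by omega) (by simpa using h)
      omega
    have hy : w.getVert i ≠ y := fun h => by
      have := hinj i w.length hi.le le_rfl (by simpa using h)
      omega
    have hiD : w.getVert i ∈ D := by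
      rcases hmem i hi.le with h | h | h
      · exact h
      · exact absurd h hx
      · exact absurd h hy
    exact ⟨(hD _ hiD).1.symm, (hD _ hiD).2⟩

open Classical in
/-- In a chordal graph, every induced subgraph has a simplicial vertex outside any given clique that
is not the whole subgraph. -/
theorem IsChordal.exists_simplicial (hG : IsChordal G) (S T : Finset V)
    (hT : G.IsClique (T : Set V)) (hTS : T ⊂ S) :
    ∃ w ∈ S, w ∉ T ∧ G.IsClique {u | u ∈ S ∧ G.Adj w u} := by
  induction hn : S.card using Nat.strong_induction_on generalizing S T with
  | _ n ih =>
  subst hn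
  -- Choosing `t` inside `T` when possible makes every non-neighbour of `t` other than `t` avoid the
  -- clique `T`.
  obtain ⟨t, htS, htT⟩ : ∃ t ∈ S, T = ∅ ∨ t ∈ T := by
    rcases T.eq_empty_or_nonempty with rfl | ⟨t, ht⟩
    · obtain ⟨t, ht⟩ := Finset.empty_ssubset.1 hTS
      exact ⟨t, ht, Or.inl rfl⟩
    · exact ⟨t, hTS.1 ht, Or.inr ht⟩
  -- A `t` adjacent to all of `S` can be deleted: putting it back keeps neighbourhoods cliques.
  by_cases huniv : ∀ u ∈ S, u ≠ t → G.Adj t u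
  · by_cases hS : S = {t}
    · refine ⟨t, htS, ?_, ?_⟩
      · rcases htT with rfl | h
        · simp
        · exact absurd (show S ⊆ T by simpa [hS] using h) hTS.2
      · rintro u ⟨hu, hau⟩
        simp only [hS, Finset.mem_singleton] at hu
        exact absurd hau (by simp [hu])
    · have hsub : T.erase t ⊂ S.erase t := by
        refine ⟨Finset.erase_subset_erase _ hTS.1, fun h => ?_⟩
        rcases htT with rfl | ht
        · refine hS (Finset.eq_singleton_iff_unique_mem.2 ⟨htS, fun x hx => ?_⟩)
          by_contra hxt
          exact absurd (h (Finset.mem_erase.2 ⟨hxt, hx⟩)) (by simp)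
        · refine hTS.2 fun x hx => ?_
          by_cases hxt : x = t
          · rwa [hxt]
          · exact (Finset.mem_erase.1 (h (Finset.mem_erase.2 ⟨hxt, hx⟩))).2
      obtain ⟨w, hwS, hwT, hw⟩ := ih _ (Finset.card_erase_lt_of_mem htS) (S.erase t) (T.erase t)
        (hT.subset (by simp)) hsub rfl
      rw [Finset.mem_erase] at hwS hwT
      refine ⟨w, hwS.2, fun h => hwT ⟨hwS.1, h⟩, ?_⟩
      rintro u ⟨hu, hwu⟩ v ⟨hv, hwv⟩ huv
      by_cases hut : u = t
      · subst hut
        exact huniv v hv huv.symm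
      · by_cases hvt : v = t
        · subst hvt
          exact (huniv u hu huv).symm
        · exact hw ⟨Finset.mem_erase.2 ⟨hut, hu⟩, hwu⟩ ⟨Finset.mem_erase.2 ⟨hvt, hv⟩, hwv⟩ huv
  · push Not at huniv
    obtain ⟨a, haS, hat, hta⟩ := huniv
    -- `C` is a component of the non-neighbours of `t`, and `U` is its boundary in `S`. The boundary
    -- lies in the neighbourhood of `t` and is a clique, since any two of its vertices are joined
    -- through `C`. Induction applies to `C ∪ U` with the clique `U`, and all neighbours in `S` of a
    -- vertex of `C` lie in `C ∪ U`.
    let D : Set V := {u | u ∈ S ∧ u ≠ t ∧ ¬ G.Adj t u}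
    have haD : a ∈ D := ⟨haS, hat, hta⟩
    let C : Finset V := S.filter fun u => (restrictEdges G D).Reachable a u
    let U : Finset V := S.filter fun u => u ∉ C ∧ ∃ x ∈ C, G.Adj x u
    have hCD : ∀ u ∈ C, u ∈ D := fun u hu =>
      mem_of_reachable_restrictEdges haD (Finset.mem_filter.1 hu).2
    have hUt : ∀ u ∈ U, G.Adj t u := by
      intro u hu
      obtain ⟨huS, huC, x, hx, hxu⟩ := Finset.mem_filter.1 hu
      by_contra hnot
      have hut : u ≠ t := by
        rintro rfl
        exact (hCD x hx).2.2 hxu.symm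
      exact huC (Finset.mem_filter.2 ⟨huS, (Finset.mem_filter.1 hx).2.trans
        (Adj.reachable ⟨hxu, hCD x hx, huS, hut, hnot⟩)⟩)
    have hUclique : G.IsClique (U : Set V) := by
      intro x hx y hy hxy
      have hx' : x ∈ U := hx
      have hy' : y ∈ U := hy
      obtain ⟨-, -, c, hc, hcx⟩ := Finset.mem_filter.1 hx'
      obtain ⟨-, -, d, hd, hdy⟩ := Finset.mem_filter.1 hy'
      refine hG.adj_of_reachable (D := D) hxy (hUt x hx') (hUt y hy') (fun d hd => hd.2) ?_
      have hcd : (restrictEdges G (D ∪ {x, y})).Reachable c d :=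
        ((Finset.mem_filter.1 hc).2.symm.trans (Finset.mem_filter.1 hd).2).mono
          (restrictEdges_mono Set.subset_union_left)
      have h1 : (restrictEdges G (D ∪ {x, y})).Reachable x c :=
        Adj.reachable ⟨hcx.symm, by simp, Or.inl (hCD c hc)⟩
      have h2 : (restrictEdges G (D ∪ {x, y})).Reachable d y :=
        Adj.reachable ⟨hdy, Or.inl (hCD d hd), by simp⟩
      exact h1.trans (hcd.trans h2)
    have haC : a ∈ C := Finset.mem_filter.2 ⟨haS, Reachable.refl _⟩
    have hCUS : C ∪ U ⊂ S := by
      refine ⟨Finset.union_subset (Finset.filter_subset _ _) (Finset.filter_subset _ _),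
        fun h => ?_⟩
      rcases Finset.mem_union.1 (h htS) with h | h
      · exact (hCD t h).2.1 rfl
      · exact (hUt t h).ne rfl
    obtain ⟨w, hw, hwU, hwc⟩ := ih _ (Finset.card_lt_card hCUS) (C ∪ U) U hUclique
      ⟨Finset.subset_union_right, fun h =>
        (Finset.mem_filter.1 (h (Finset.mem_union_left _ haC))).2.1 haC⟩ rfl
    have hwC : w ∈ C := (Finset.mem_union.1 hw).resolve_right hwU
    refine ⟨w, hCUS.1 hw, ?_, hwc.subset ?_⟩
    · rcases htT with rfl | ht
      · simp
      · exact fun h => (hCD w hwC).2.2 (hT ht h (hCD w hwC).2.1.symm)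
    · rintro u ⟨huS, hwu⟩
      refine ⟨?_, hwu⟩
      by_cases huC : u ∈ C
      · exact Finset.mem_union_left _ huC
      · exact Finset.mem_union_right _ (Finset.mem_filter.2 ⟨huS, huC, w, hwC, hwu⟩)

end Graph

open Matrix

/-! ### Kernels and ranges of positive semidefinite matrices -/

section LinearAlgebra

variable {V : Type*} [Fintype V]

theorem posSemidef_iff_isSymm {A : Matrix V V ℝ} :
    A.PosSemidef ↔ A.IsSymm ∧ ∀ x, 0 ≤ x ⬝ᵥ A *ᵥ x := by
  rw [posSemidef_iff_dotProduct_mulVec]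
  simp [IsHermitian, IsSymm, conjTranspose_eq_transpose_of_trivial]

theorem mulVec_eq_zero_of_dotProduct {A : Matrix V V ℝ} (hA : A.PosSemidef) {x : V → ℝ}
    (h : x ⬝ᵥ A *ᵥ x = 0) : A *ᵥ x = 0 :=
  (hA.dotProduct_mulVec_zero_iff x).1 (by simpa using h)

theorem dotProduct_mulVec_comm {A : Matrix V V ℝ} (hA : A.IsSymm) (x y : V → ℝ) :
    x ⬝ᵥ A *ᵥ y = y ⬝ᵥ A *ᵥ x := by
  rw [dotProduct_mulVec, dotProduct_comm, ← mulVec_transpose, hA.eq]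

/-- A vector orthogonal to the kernel of a symmetric matrix lies in its range. -/
theorem exists_mulVec_eq_of_orthogonal_ker {A : Matrix V V ℝ} (hA : A.IsSymm) {b : V → ℝ}
    (hb : ∀ z, A *ᵥ z = 0 → b ⬝ᵥ z = 0) : ∃ y, A *ᵥ y = b := by
  classical
  have hmem : dotProductEquiv ℝ V b ∈ LinearMap.range A.mulVecLin.dualMap := by
    rw [LinearMap.range_dualMap_eq_dualAnnihilator_ker, Submodule.mem_dualAnnihilator]
    intro z hz
    exact hb z hz
  obtain ⟨f, hf⟩ := hmem
  obtain ⟨y, rfl⟩ := (dotProductEquiv ℝ V).surjective f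
  refine ⟨y, funext fun j => ?_⟩
  have := LinearMap.congr_fun hf (Pi.single j 1)
  simp only [LinearMap.dualMap_apply, dotProductEquiv_apply_apply, mulVecLin_apply,
    dotProduct_single, mul_one] at this
  rw [dotProduct_mulVec_comm hA, single_one_dotProduct] at this
  exact this

/-- Two positive semidefinite matrices with nonpositive inner product annihilate each other. -/
theorem mulVec_mulVec_eq_zero_of_trace_mul_nonpos {A B : Matrix V V ℝ} (hA : A.PosSemidef)
    (hB : B.PosSemidef) (h : (A * B).trace ≤ 0) (x : V → ℝ) : A *ᵥ (B *ᵥ x) = 0 := by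
  classical
  -- A decomposition of `B` into rank-one terms makes the trace a sum of nonnegative values `vᵀ A
  -- v`, so each vanishes.
  obtain ⟨m, v, rfl⟩ := posSemidef_iff_eq_sum_vecMulVec.1 hB
  have hnn : ∀ i ∈ Finset.univ, 0 ≤ v i ⬝ᵥ A *ᵥ v i := fun i _ => (posSemidef_iff_isSymm.1 hA).2 _
  have hsum : (A * ∑ i, vecMulVec (v i) (star (v i))).trace = ∑ i, v i ⬝ᵥ A *ᵥ v i := by
    rw [Matrix.mul_sum, trace_sum]
    refine Finset.sum_congr rfl fun i _ => ?_
    rw [mul_vecMulVec, trace_vecMulVec, dotProduct_comm, star_trivial]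
  have hzero : ∀ i, A *ᵥ v i = 0 := fun i => mulVec_eq_zero_of_dotProduct hA <|
    (Finset.sum_eq_zero_iff_of_nonneg hnn).1
      (le_antisymm (hsum ▸ h) (Finset.sum_nonneg hnn)) i (Finset.mem_univ i)
  rw [mulVec_mulVec, Matrix.mul_sum]
  simp only [mul_vecMulVec, hzero, zero_vecMulVec, Finset.sum_const_zero, zero_mulVec]

/-- Orthogonal projection in the semi-inner product of `X`, onto the span of the coordinate
vectors in `N`. -/
theorem exists_supported_mulVec_eq {X : Matrix V V ℝ} (hX : X.PosSemidef) (N : Set V) (v : V) :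
    ∃ y : V → ℝ, (∀ i ∉ N, y i = 0) ∧ ∀ i ∈ N, (X *ᵥ y) i = X i v := by
  classical
  let D : Matrix V V ℝ := diagonal (N.indicator 1)
  have hDapp : ∀ x i, (D *ᵥ x) i = N.indicator 1 i * x i := fun x i => mulVec_diagonal _ _ _
  have hDsymm : Dᵀ = D := diagonal_transpose _
  have hA : (D * X * D).PosSemidef := by
    have := hX.conjTranspose_mul_mul_same D
    rwa [conjTranspose_eq_transpose_of_trivial, hDsymm] at this
  have hDX : ∀ a b, a ⬝ᵥ D *ᵥ b = (D *ᵥ a) ⬝ᵥ b := by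
    intro a b
    rw [dotProduct_mulVec, ← mulVec_transpose, hDsymm]
  -- The normal equations `D X D y = D X e_v` are solvable even for singular `X`: a null vector `z`
  -- of `D X D` satisfies `X D z = 0`.
  obtain ⟨y, hy⟩ := exists_mulVec_eq_of_orthogonal_ker (posSemidef_iff_isSymm.1 hA).1
    (b := D *ᵥ X *ᵥ Pi.single v 1) (by
      intro z hz
      have h0 : X *ᵥ D *ᵥ z = 0 := by
        refine mulVec_eq_zero_of_dotProduct hX ?_
        rw [← hDX, mulVec_mulVec, mulVec_mulVec, hz, dotProduct_zero]
      rw [← hDX, dotProduct_comm, dotProduct_mulVec_comm (posSemidef_iff_isSymm.1 hX).1, h0,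
        dotProduct_zero])
  refine ⟨D *ᵥ y, fun i hi => by rw [hDapp, Set.indicator_of_notMem hi, zero_mul], fun i hi => ?_⟩
  have := congrFun hy i
  rw [← mulVec_mulVec, ← mulVec_mulVec, hDapp, hDapp, Set.indicator_of_mem hi, Pi.one_apply,
    one_mul, one_mul] at this
  rw [this, mulVec_single_one]
  rfl

end LinearAlgebra

/-! ### Completion along simplicial vertices -/

section Completion

variable {V : Type*} [Fintype V] {G : SimpleGraph V}

open Classical in
/-- On a chordal graph, the entries of a positive semidefinite matrix on a vertex set have a
positive semidefinite completion whose kernel is spanned by null vectors supported on cliques. -/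
theorem IsChordal.exists_completion (hG : IsChordal G) {X₀ : Matrix V V ℝ} (h₀ : X₀.PosSemidef)
    (S : Finset V) :
    ∃ X : Matrix V V ℝ, X.PosSemidef ∧
      (∀ i ∈ S, ∀ j ∈ S, i = j ∨ G.Adj i j → X i j = X₀ i j) ∧
      ∀ z : V → ℝ, Function.support z ⊆ S → X *ᵥ z = 0 → z ∈ Submodule.span ℝ
        {w : V → ℝ | G.IsClique (Function.support w) ∧ Function.support w ⊆ S ∧ X *ᵥ w = 0} := by
  induction hn : S.card generalizing S with
  | zero =>
    obtain rfl := Finset.card_eq_zero.1 hn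
    refine ⟨0, PosSemidef.zero, by simp, fun z hz _ => ?_⟩
    have : z = 0 := by simpa using hz
    rw [this]
    exact Submodule.zero_mem _
  | succ n ih =>
    obtain ⟨v, hv, -, hclique⟩ := hG.exists_simplicial S ∅ (by simp)
      (Finset.empty_ssubset.2 (Finset.card_pos.1 (by omega)))
    obtain ⟨X, hX, hXeq, hXker⟩ := ih (S.erase v) (by rw [Finset.card_erase_of_mem hv, hn]; rfl)
    set N : Set V := {u | u ∈ S ∧ G.Adj v u}
    have hNne : ∀ i ∈ N, i ≠ v := fun i hi => hi.2.ne'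
    -- In terms of Gram vectors of `X₀`, `y` holds the coefficients of the projection of the vector
    -- of `v` onto the span of those of its neighbours.
    obtain ⟨y, hyN, hy⟩ := exists_supported_mulVec_eq h₀ N v
    have hyv : y v = 0 := hyN v fun h => hNne v h rfl
    let e : V → ℝ := Pi.single v 1
    -- the Schur complement of the column of `v`
    set s : ℝ := (e - y) ⬝ᵥ X₀ *ᵥ (e - y) with hs
    have hs0 : 0 ≤ s := (posSemidef_iff_isSymm.1 h₀).2 _
    let M : Matrix V V ℝ := 1 + vecMulVec (y - e) e
    have hM : ∀ z, M *ᵥ z = z - z v • (e - y) := by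
      intro z
      simp only [M, add_mulVec, one_mulVec, vecMulVec_mulVec, e, single_one_dotProduct]
      ext i
      simp
      ring
    have hMe : M *ᵥ e = y := by
      rw [hM]; simp [e]
    have hM' : ∀ z : V → ℝ, z v = 0 → M *ᵥ z = z := by
      intro z hz
      rw [hM, hz]; simp
    -- The new Gram vector of `v` is the combination `y` of the old ones plus a fresh orthogonal
    -- component of squared length `s`; `M` substitutes `y` for `e`.
    let Y : Matrix V V ℝ := Mᵀ * X * M + s • vecMulVec e e
    have hYform : ∀ a b, a ⬝ᵥ Y *ᵥ b = (M *ᵥ a) ⬝ᵥ X *ᵥ (M *ᵥ b) + s * (a v * b v) := by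
      intro a b
      simp only [Y, add_mulVec, ← mulVec_mulVec, dotProduct_add, smul_mulVec, vecMulVec_mulVec]
      rw [dotProduct_mulVec a, vecMul_transpose]
      simp only [e, dotProduct_smul, dotProduct_single_one, single_one_dotProduct, smul_eq_mul,
        op_smul_eq_smul]
      ring
    have hYps : Y.PosSemidef := by
      refine PosSemidef.add ?_ (PosSemidef.smul ?_ hs0)
      · simpa [conjTranspose_eq_transpose_of_trivial] using hX.conjTranspose_mul_mul_same M
      · simpa using posSemidef_vecMulVec_self_star e
    have hYsymm := (posSemidef_iff_isSymm.1 hYps).1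
    have hYent : ∀ i j, Y i j = Pi.single i 1 ⬝ᵥ Y *ᵥ Pi.single j 1 := by
      intro i j
      simp
    -- Since `N` is a clique, `X` agrees with `X₀` on it, so `y` solves the same equations for `X`.
    have hXy : ∀ i ∈ N, (X *ᵥ y) i = X₀ i v := by
      intro i hi
      rw [← hy i hi]
      refine Finset.sum_congr rfl fun u _ => ?_
      by_cases hu : u ∈ N
      · change X i u * y u = X₀ i u * y u
        rw [hXeq i (Finset.mem_erase.2 ⟨hNne i hi, hi.1⟩) u (Finset.mem_erase.2 ⟨hNne u hu, hu.1⟩)]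
        by_cases hiu : i = u
        · exact Or.inl hiu
        · exact Or.inr (hclique hi hu hiu)
      · rw [hyN u hu, mul_zero, mul_zero]
    have hYv : ∀ i ∈ N, Y i v = X₀ i v := by
      intro i hi
      have hiv : (Pi.single i 1 : V → ℝ) v = 0 := by simp [(hNne i hi).symm]
      rw [hYent, hYform, hM' _ hiv, show M *ᵥ Pi.single v 1 = y from hMe, hiv,
        single_one_dotProduct, hXy i hi]
      simp
    have hYvv : Y v v = X₀ v v := by
      have h1 : y ⬝ᵥ X *ᵥ y = y ⬝ᵥ X₀ *ᵥ e := by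
        refine Finset.sum_congr rfl fun u _ => ?_
        by_cases hu : u ∈ N
        · rw [hXy u hu, mulVec_single_one]; rfl
        · rw [hyN u hu, zero_mul, zero_mul]
      have h2 : y ⬝ᵥ X₀ *ᵥ y = y ⬝ᵥ X₀ *ᵥ e := by
        refine Finset.sum_congr rfl fun u _ => ?_
        by_cases hu : u ∈ N
        · rw [hy u hu, mulVec_single_one]; rfl
        · rw [hyN u hu, zero_mul, zero_mul]
      have h3 : s = X₀ v v - y ⬝ᵥ X₀ *ᵥ e := by
        rw [hs, mulVec_sub, sub_dotProduct, dotProduct_sub, dotProduct_sub, h2,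
          dotProduct_mulVec_comm (posSemidef_iff_isSymm.1 h₀).1 e y]
        simp [e]
      rw [hYent, hYform, show M *ᵥ Pi.single v 1 = y from hMe, h1, h3]
      simp
    refine ⟨Y, hYps, ?_, ?_⟩
    · intro i hi j hj hij
      by_cases hiv : i = v
      · subst hiv
        by_cases hjv : j = i
        · rw [hjv, hYvv]
        · have : G.Adj i j := hij.resolve_left fun h => hjv h.symm
          rw [← hYsymm.apply, hYv j ⟨hj, this⟩, (posSemidef_iff_isSymm.1 h₀).1.apply]
      · by_cases hjv : j = v
        · subst hjv
          exact hYv i ⟨hi, (hij.resolve_left hiv).symm⟩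
        · have h1 : (Pi.single i 1 : V → ℝ) v = 0 := by simp [Ne.symm hiv]
          have h2 : (Pi.single j 1 : V → ℝ) v = 0 := by simp [Ne.symm hjv]
          rw [hYent, hYform, hM' _ h1, hM' _ h2, h1,
            ← hXeq i (Finset.mem_erase.2 ⟨hiv, hi⟩) j (Finset.mem_erase.2 ⟨hjv, hj⟩) hij]
          simp
    · intro z hz hYz
      have h0 : (M *ᵥ z) ⬝ᵥ X *ᵥ (M *ᵥ z) + s * (z v * z v) = 0 := by
        rw [← hYform, hYz, dotProduct_zero]
      have hnn1 : 0 ≤ (M *ᵥ z) ⬝ᵥ X *ᵥ (M *ᵥ z) := (posSemidef_iff_isSymm.1 hX).2 _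
      have hnn2 : 0 ≤ s * (z v * z v) := mul_nonneg hs0 (mul_self_nonneg _)
      have hMz : M *ᵥ z ∈ Submodule.span ℝ {w : V → ℝ | G.IsClique (Function.support w) ∧
          Function.support w ⊆ (S.erase v : Finset V) ∧ X *ᵥ w = 0} := by
        refine hXker _ (fun i hi => ?_) (mulVec_eq_zero_of_dotProduct hX (by linarith))
        by_contra hiS
        refine hi ?_
        have hi' : i = v ∨ i ∉ S := by
          by_contra! h
          exact hiS (Finset.mem_erase.2 h)
        rw [hM]
        rcases hi' with rfl | h
        · simp [e, hyv]
        · have hzi : z i = 0 := by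
            by_contra hne
            exact h (hz hne)
          have hyi : y i = 0 := hyN i fun h' => h h'.1
          have hiv : i ≠ v := fun h' => h (h' ▸ hv)
          simp [e, hzi, hyi, hiv]
      -- The first summand falls under the induction hypothesis. The second matters only if `z v ≠
      -- 0`; then `s = 0`, and `e - y` is a null vector supported on the clique formed by `v` and
      -- its neighbours.
      have hz' : z = M *ᵥ z + z v • (e - y) := by rw [hM]; abel
      rw [hz']
      refine Submodule.add_mem _ (Submodule.span_mono ?_ hMz) ?_
      · rintro w ⟨hwc, hwS, hw⟩
        have hwv : w v = 0 := by
          by_contra hne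
          simpa using hwS hne
        refine ⟨hwc, hwS.trans (by simp), mulVec_eq_zero_of_dotProduct hYps ?_⟩
        rw [hYform, hM' w hwv, hw, hwv]
        simp
      · by_cases hzv : z v = 0
        · simp [hzv]
        · have hs' : s = 0 := by
            have : s * (z v * z v) = 0 := by linarith
            simpa [hzv] using this
          have hsupp : ∀ i, (e - y) i ≠ 0 → i = v ∨ i ∈ N := by
            intro i hi
            by_contra! h
            exact hi (by simp [e, h.1, hyN i h.2])
          refine Submodule.smul_mem _ _ (Submodule.subset_span ⟨?_, ?_, ?_⟩)
          · intro i hi j hj hij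
            rcases hsupp i hi with rfl | hi' <;> rcases hsupp j hj with rfl | hj'
            · exact absurd rfl hij
            · exact hj'.2
            · exact hi'.2.symm
            · exact hclique hi' hj' hij
          · intro i hi
            rcases hsupp i hi with rfl | hi'
            · exact hv
            · exact hi'.1
          · refine mulVec_eq_zero_of_dotProduct hYps ?_
            have : M *ᵥ (e - y) = 0 := by rw [hM]; simp [e, hyv]
            rw [hYform, this, hs']
            simp

end Completion

/-! ### Stress matrices and the dual value -/

section DualValue

variable {V : Type*} {G : SimpleGraph V}

theorem stressMatrix_isSymm (ω : V ⊕ G.edgeSet → ℝ) : (stressMatrix G ω).IsSymm := by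
  ext i j
  simp only [stressMatrix, transpose_apply, of_apply]
  by_cases hij : i = j
  · simp [hij]
  · have hji : ¬ j = i := fun h => hij h.symm
    by_cases h : G.Adj i j
    · simp [hij, hji, h, h.symm, Sym2.eq_swap]
    · have h' : ¬ G.Adj j i := fun h' => h h'.symm
      simp [hij, hji, h, h']

theorem stressMatrix_apply_eq_zero (ω : V ⊕ G.edgeSet → ℝ) {i j : V} (hij : i ≠ j)
    (h : ¬ G.Adj i j) : stressMatrix G ω i j = 0 := by
  simp [stressMatrix, hij, h]

/-- The stress matrices are the symmetric matrices supported on the diagonal and the edges. -/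
theorem exists_stressMatrix_eq {Ω : Matrix V V ℝ} (hΩ : Ω.IsSymm)
    (hG : ∀ i j, i ≠ j → ¬ G.Adj i j → Ω i j = 0) : ∃ ω, stressMatrix G ω = Ω := by
  refine ⟨Sum.elim (fun i => Ω i i) fun e =>
    2 * Sym2.lift ⟨fun i j => Ω i j, fun i j => (hΩ.apply i j).symm⟩ e.1, ?_⟩
  ext i j
  simp only [stressMatrix, of_apply]
  by_cases hij : i = j
  · simp [hij]
  · by_cases h : G.Adj i j
    · simp [hij, h]
    · simp [hij, h, hG i j hij h]

variable [Fintype V]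

open Classical in
-- Each edge arises from two ordered pairs, which the halves compensate.
theorem sum_sum_dite_adj (f : G.edgeSet → ℝ) :
    ∑ i, ∑ j, (if h : G.Adj i j then f ⟨s(i, j), h⟩ / 2 else 0) = ∑ e, f e := by
  have h1 : ∀ i j, (if h : G.Adj i j then f ⟨s(i, j), h⟩ / 2 else 0) =
      ∑ e : G.edgeSet, if e.1 = s(i, j) then f e / 2 else 0 := by
    intro i j
    split_ifs with h
    · rw [Finset.sum_eq_single_of_mem (⟨s(i, j), h⟩ : G.edgeSet) (Finset.mem_univ _)
        (fun e _ he => if_neg fun h' => he (Subtype.ext h')), if_pos rfl]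
    · refine (Finset.sum_eq_zero fun e _ => if_neg fun h' => h ?_).symm
      have := e.2
      rwa [h', SimpleGraph.mem_edgeSet] at this
  simp only [h1]
  rw [Finset.sum_congr rfl fun i _ => Finset.sum_comm, Finset.sum_comm]
  refine Finset.sum_congr rfl fun e _ => ?_
  obtain ⟨e, he⟩ := e
  induction e using Sym2.ind with
  | _ a b =>
  have hab : a ≠ b := (show G.Adj a b from he).ne
  have h2 : ∀ i j, (if s(a, b) = s(i, j) then f ⟨s(a, b), he⟩ / 2 else 0) =
      (if a = i then if b = j then f ⟨s(a, b), he⟩ / 2 else 0 else 0) +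
      (if b = i then if a = j then f ⟨s(a, b), he⟩ / 2 else 0 else 0) := by
    intro i j
    simp only [Sym2.eq_iff]
    by_cases h1 : a = i <;> by_cases h2 : b = j <;> by_cases h3 : a = j <;> by_cases h4 : b = i <;>
      simp_all
  simp only [h2, Finset.sum_add_distrib]
  simp

/-- A stress matrix only sees the entries of `X` prescribed by the problem, so any feasible `X`
computes the dual value. -/
theorem dualValue_eq_trace {c : G.edgeSet → ℝ} {X : Matrix V V ℝ} (hX : X ∈ feasibleSet G c)
    (ω : V ⊕ G.edgeSet → ℝ) : dualValue G c ω = (stressMatrix G ω * X).trace := by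
  classical
  have hsymm := (posSemidef_iff_isSymm.1 hX.1).1
  have hentry : ∀ i j, stressMatrix G ω i j * X j i =
      (if i = j then ω (Sum.inl i) else 0) +
      (if h : G.Adj i j then ω (Sum.inr ⟨s(i, j), h⟩) * c ⟨s(i, j), h⟩ / 2 else 0) := by
    intro i j
    simp only [stressMatrix, of_apply]
    by_cases hij : i = j
    · subst hij
      simp [hX.2.1]
    · by_cases h : G.Adj i j
      · rw [hsymm.apply, hX.2.2 i j h]
        simp only [hij, h, if_false, dif_pos]
        ring
      · simp [hij, h]
  have h3 := sum_sum_dite_adj (G := G) fun e => ω (Sum.inr e) * c e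
  simp only [trace, diag_apply, Matrix.mul_apply, hentry, Finset.sum_add_distrib]
  rw [h3]
  simp only [dualValue, Finset.sum_ite_eq, Finset.mem_univ, if_true]

end DualValue

/-! ### Relative interior and facial reduction of length at most one -/

section FeasibleSet

variable {V : Type*} [Fintype V] {G : SimpleGraph V}

theorem convex_feasibleSet {V : Type*} {G : SimpleGraph V} (c : G.edgeSet → ℝ) : Convex ℝ (feasibleSet G c) := by
  intro X hX Y hY a b ha hb hab
  refine ⟨(hX.1.smul ha).add (hY.1.smul hb), fun i => ?_, fun i j h => ?_⟩
  · simp [hX.2.1, hY.2.1, hab]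
  · simp [hX.2.2 i j h, hY.2.2 i j h, ← add_mul, hab]

-- The norm serves only to apply the existence theorem for convex sets in finite-dimensional normed
-- spaces.
attribute [local instance] Matrix.normedAddCommGroup Matrix.normedSpace in
theorem intrinsicInterior_feasibleSet_nonempty {c : G.edgeSet → ℝ}
    (hc : (feasibleSet G c).Nonempty) : (intrinsicInterior ℝ (feasibleSet G c)).Nonempty :=
  hc.intrinsicInterior (convex_feasibleSet c)

/-- From a point of the relative interior, one can move slightly away from any other point of the
set. -/
theorem exists_pos_lineMap_neg_mem {E : Type*} [AddCommGroup E] [Module ℝ E] [TopologicalSpace E]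
    [IsTopologicalAddGroup E] [ContinuousSMul ℝ E] {s : Set E} {x y : E}
    (hx : x ∈ intrinsicInterior ℝ s) (hy : y ∈ s) :
    ∃ ε : ℝ, 0 < ε ∧ AffineMap.lineMap x y (-ε) ∈ s := by
  obtain ⟨p, hp, rfl⟩ := hx
  let γ : ℝ → affineSpan ℝ s := fun t =>
    ⟨AffineMap.lineMap (p : E) y (-t), AffineMap.lineMap_mem _ p.2 (subset_affineSpan ℝ s hy)⟩
  have hγ : Continuous γ := by
    refine Continuous.subtype_mk ?_ _
    simp only [AffineMap.lineMap_apply_module]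
    fun_prop
  have h0 : γ 0 = p := Subtype.ext (by simp [γ])
  have hnhds : ∀ᶠ t in nhds (0 : ℝ), (γ t : E) ∈ s :=
    hγ.continuousAt.eventually (by rw [h0]; exact mem_interior_iff_mem_nhds.1 hp)
  obtain ⟨t, ht, ht0⟩ := ((hnhds.filter_mono nhdsWithin_le_nhds).and
    (self_mem_nhdsWithin (s := Set.Ioi (0 : ℝ)))).exists
  exact ⟨t, ht0, ht⟩

/-- A relative interior point of the feasible set has the smallest kernel. -/
theorem mulVec_eq_zero_of_mem_intrinsicInterior {c : G.edgeSet → ℝ} {X Y : Matrix V V ℝ}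
    (hX : X ∈ intrinsicInterior ℝ (feasibleSet G c)) (hY : Y ∈ feasibleSet G c) {z : V → ℝ}
    (hz : X *ᵥ z = 0) : Y *ᵥ z = 0 := by
  -- The matrix `(1 + ε) X - ε Y` is feasible, so its form at `z`, which is `-ε zᵀ Y z`, is
  -- nonnegative.
  obtain ⟨ε, hε, hmem⟩ := exists_pos_lineMap_neg_mem hX hY
  have h1 := (posSemidef_iff_isSymm.1 hmem.1).2 z
  have h2 := (posSemidef_iff_isSymm.1 hY.1).2 z
  rw [AffineMap.lineMap_apply_module, add_mulVec, smul_mulVec, smul_mulVec, hz, smul_zero, zero_add,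
    dotProduct_smul, smul_eq_mul] at h1
  refine mulVec_eq_zero_of_dotProduct hY.1 (le_antisymm ?_ h2)
  nlinarith

/-- Complementary slackness: the dual value is the trace of `Ω X`, and two positive semidefinite
matrices with nonpositive inner product annihilate each other. -/
theorem stressMatrix_mulVec_mulVec_eq_zero {c : G.edgeSet → ℝ} {X : Matrix V V ℝ}
    (hX : X ∈ feasibleSet G c) {ω : V ⊕ G.edgeSet → ℝ} (hω : (stressMatrix G ω).PosSemidef)
    (hval : dualValue G c ω ≤ 0) (x : V → ℝ) : stressMatrix G ω *ᵥ (X *ᵥ x) = 0 :=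
  mulVec_mulVec_eq_zero_of_trace_mul_nonpos hω hX.1 (dualValue_eq_trace hX ω ▸ hval) x

theorem nullCone_one (Y : Fin 1 → Matrix V V ℝ) :
    nullCone Y 1 = {x | x ⬝ᵥ Y 0 *ᵥ x = 0} := by
  ext x
  simp [nullCone, Fin.forall_fin_one]

theorem finrank_range_mulVec (X : Matrix V V ℝ) :
    (Set.range fun y => X *ᵥ y).finrank ℝ = X.rank := by
  have : (Set.range fun y => X *ᵥ y) = (LinearMap.range X.mulVecLin : Set (V → ℝ)) := by
    ext; simp
  rw [this, Set.finrank, Submodule.span_eq, Matrix.rank]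

theorem singularityDegree_le_one_iff : singularityDegree G ≤ 1 ↔ ∀ c ∈ feasibleWeights G,
    ∃ k ≤ 1, ∃ ω : Fin k → V ⊕ G.edgeSet → ℝ, IsFacialReduction G c ω := by
  simp only [singularityDegree, iSup_le_iff]
  refine forall₂_congr fun c _ => ⟨fun h => ?_, ?_⟩
  · have h2 : weightSingularityDegree G c < 2 := h.trans_lt (by norm_num)
    simp only [weightSingularityDegree, iInf_lt_iff] at h2
    obtain ⟨k, hk, hlt⟩ := h2
    exact ⟨k, Nat.lt_succ_iff.1 (by exact_mod_cast hlt), hk⟩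
  · rintro ⟨k, hk, hω⟩
    exact (iInf₂_le k hω).trans (by exact_mod_cast hk)

end FeasibleSet

/-! ### Chordal graphs have singularity degree at most one -/

section Chordal

variable {V : Type*} [Fintype V] {G : SimpleGraph V}

/-- The sum of `w wᵀ` over finitely many clique-supported `w` spanning `ker X` does it. Length
exactly one works even if `X` is positive definite, with zero stress matrix. -/
theorem IsChordal.exists_isFacialReduction (hG : IsChordal G) {c : G.edgeSet → ℝ}
    (hc : c ∈ feasibleWeights G) :
    ∃ ω : Fin 1 → V ⊕ G.edgeSet → ℝ, IsFacialReduction G c ω := by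
  classical
  obtain ⟨X₀, hX₀⟩ := hc
  obtain ⟨X, hXps, hXeq, hXker⟩ := hG.exists_completion hX₀.1 Finset.univ
  have hX : X ∈ feasibleSet G c := by
    refine ⟨hXps, fun i => ?_, fun i j h => ?_⟩
    · rw [hXeq i (Finset.mem_univ _) i (Finset.mem_univ _) (Or.inl rfl), hX₀.2.1]
    · rw [hXeq i (Finset.mem_univ _) j (Finset.mem_univ _) (Or.inr h), hX₀.2.2 i j h]
  obtain ⟨Z, hZ⟩ := intrinsicInterior_feasibleSet_nonempty ⟨X, hX⟩
  have hZF := intrinsicInterior_subset hZ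
  obtain ⟨t, htW, ht⟩ := (Submodule.fg_span_iff_fg_span_finset_subset _).1
    (IsNoetherian.noetherian (Submodule.span ℝ {w : V → ℝ | G.IsClique (Function.support w) ∧
      Function.support w ⊆ (Finset.univ : Finset V) ∧ X *ᵥ w = 0}))
  let Ω : Matrix V V ℝ := ∑ w ∈ t, vecMulVec w w
  have hΩps : Ω.PosSemidef := posSemidef_sum _ fun w _ => by
    simpa using posSemidef_vecMulVec_self_star w
  obtain ⟨ω, hω⟩ := exists_stressMatrix_eq (G := G) (posSemidef_iff_isSymm.1 hΩps).1 (by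
    intro i j hij hadj
    simp only [Ω, Matrix.sum_apply, vecMulVec_apply]
    refine Finset.sum_eq_zero fun w hw => ?_
    by_contra hne
    rw [mul_eq_zero, not_or] at hne
    exact hadj ((htW hw).1 hne.1 hne.2 hij))
  have hform : ∀ x, x ⬝ᵥ Ω *ᵥ x = ∑ w ∈ t, (w ⬝ᵥ x) * (w ⬝ᵥ x) := by
    intro x
    simp only [Ω, sum_mulVec, dotProduct_sum, vecMulVec_mulVec]
    refine Finset.sum_congr rfl fun w _ => ?_
    simp [dotProduct_comm x w]
  have hval : dualValue G c ω ≤ 0 := by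
    have hXΩ : X * Ω = 0 := by
      simp only [Ω, Matrix.mul_sum, mul_vecMulVec]
      exact Finset.sum_eq_zero fun w hw => by rw [(htW hw).2.2, zero_vecMulVec]
    rw [dualValue_eq_trace hX, hω, trace_mul_comm, hXΩ, trace_zero]
  refine ⟨fun _ => ω, ⟨fun j => ⟨stressMatrix_isSymm ω, fun x _ => ?_⟩, fun _ => hval, Z, hZ, ?_⟩⟩
  · change 0 ≤ x ⬝ᵥ stressMatrix G ω *ᵥ x
    rw [hω]
    exact (posSemidef_iff_isSymm.1 hΩps).2 x
  · rw [nullCone_one, hω, ← finrank_range_mulVec]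
    congr 1
    ext x
    constructor
    · intro hx
      have hx' : ∑ w ∈ t, (w ⬝ᵥ x) * (w ⬝ᵥ x) = 0 := by
        rw [← hform]
        exact hx
      have hwx : ∀ w ∈ t, w ⬝ᵥ x = 0 := fun w hw => mul_self_eq_zero.1
        ((Finset.sum_eq_zero_iff_of_nonneg fun w _ => mul_self_nonneg _).1 hx' w hw)
      -- Here `x` is orthogonal to `ker X`, hence to the smaller `ker Z`, so it lies in the range of
      -- `Z`.
      refine exists_mulVec_eq_of_orthogonal_ker (posSemidef_iff_isSymm.1 hZF.1).1 fun z hz => ?_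
      have hzt := hXker z (by simp) (mulVec_eq_zero_of_mem_intrinsicInterior hZ hX hz)
      have hle : Submodule.span ℝ (t : Set (V → ℝ)) ≤ LinearMap.ker (dotProductEquiv ℝ V x) :=
        Submodule.span_le.2 fun w hw => by
          change x ⬝ᵥ w = 0
          rw [dotProduct_comm, hwx w hw]
      exact hle (ht ▸ hzt)
    · rintro ⟨y, rfl⟩
      change _ ⬝ᵥ Ω *ᵥ (Z *ᵥ y) = 0
      rw [← hω, stressMatrix_mulVec_mulVec_eq_zero hZF (hω ▸ hΩps) hval, dotProduct_zero]

end Chordal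

/-! ### A hole forces singularity degree at least two -/

section Hole

variable {V : Type*} [Fintype V] {G : SimpleGraph V}

/-- Unit vectors with inner product one coincide: `e_a - e_b` is a null vector of `X`. -/
theorem apply_eq_apply_of_apply_eq_one {X : Matrix V V ℝ} (hX : X.PosSemidef) {a b : V}
    (haa : X a a = 1) (hbb : X b b = 1) (hab : X a b = 1) (x : V) : X x a = X x b := by
  classical
  have hba : X b a = 1 := by rw [(posSemidef_iff_isSymm.1 hX).1.apply, hab]
  have h : X *ᵥ (Pi.single a 1 - Pi.single b 1) = 0 := by
    refine mulVec_eq_zero_of_dotProduct hX ?_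
    simp [mulVec_sub, haa, hbb, hab, hba]
  simpa [mulVec_sub, sub_eq_zero] using congrFun h x

/-- If the final space of a facial reduction sequence contains the range of `X` and has
dimension `rank X`, then it is the range of `X`. -/
theorem exists_mulVec_eq_of_finrank_eq {X : Matrix V V ℝ} {N : Submodule ℝ (V → ℝ)}
    (hN : ∀ y, X *ᵥ y ∈ N) (h : Module.finrank ℝ N = X.rank) {x : V → ℝ} (hx : x ∈ N) :
    ∃ y, X *ᵥ y = x := by
  have hle : LinearMap.range X.mulVecLin ≤ N := by
    rintro _ ⟨y, rfl⟩
    exact hN y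
  rw [← Submodule.eq_of_le_of_finrank_eq hle h.symm] at hx
  exact hx

variable {n : ℕ}

/-- First coordinates of the points on the hole. -/
noncomputable def holeFst (n : ℕ) (i : Fin n) : ℝ :=
  if i.val ≤ 1 then 1 else if i.val = 2 then 1 / 2 else -1 / 2

/-- Second coordinates of the points on the hole, divided by `√3 / 2`. -/
noncomputable def holeSnd (n : ℕ) (i : Fin n) : ℝ :=
  if i.val ≤ 1 then 0 else 1

open Classical in
/-- The Gram matrix of unit vectors placed on the vertices of `G`: along a hole two coincident
vectors `a`, then `a + b`, then copies of `b`, where `a` and `b` are at an angle of 120 degrees;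
elsewhere new orthonormal vectors. -/
noncomputable def holeGram (φ : Fin n → V) : Matrix V V ℝ :=
  vecMulVec (Function.extend φ (holeFst n) 0) (Function.extend φ (holeFst n) 0) +
    (3 / 4 : ℝ) • vecMulVec (Function.extend φ (holeSnd n) 0) (Function.extend φ (holeSnd n) 0) +
    diagonal fun v => if v ∈ Set.range φ then 0 else 1

theorem holeGram_posSemidef (φ : Fin n → V) : (holeGram φ).PosSemidef := by
  classical
  refine ((?_ : PosSemidef _).add (PosSemidef.smul ?_ (by norm_num))).add
    (PosSemidef.diagonal fun v => ?_)
  · simpa using posSemidef_vecMulVec_self_star (Function.extend φ (holeFst n) 0)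
  · simpa using posSemidef_vecMulVec_self_star (Function.extend φ (holeSnd n) 0)
  · simp only [Pi.zero_apply]
    split_ifs <;> norm_num

theorem holeGram_apply {V : Type*} {φ : Fin n → V} (hφ : Function.Injective φ) (i j : Fin n) :
    holeGram φ (φ i) (φ j) = holeFst n i * holeFst n j + 3 / 4 * (holeSnd n i * holeSnd n j) := by
  simp [holeGram, vecMulVec_apply, hφ.extend_apply, diagonal_apply]

theorem holeGram_apply_self {V : Type*} {φ : Fin n → V} (hφ : Function.Injective φ) (v : V) :
    holeGram φ v v = 1 := by
  by_cases hv : ∃ i, φ i = v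
  · obtain ⟨i, rfl⟩ := hv
    rw [holeGram_apply hφ]
    simp only [holeFst, holeSnd]
    split_ifs <;> norm_num
  · simp only [holeGram, Matrix.add_apply, Matrix.smul_apply, vecMulVec_apply, Function.extend_apply' _ _ _ hv,
      diagonal_apply_eq]
    simp [show v ∉ Set.range φ from hv]

/-- The edge weights given by the entries of `holeGram`. -/
noncomputable def holeWeight (G : SimpleGraph V) (φ : Fin n → V) (e : G.edgeSet) : ℝ :=
  Sym2.lift ⟨fun i j => holeGram φ i j, fun i j =>
    ((posSemidef_iff_isSymm.1 (holeGram_posSemidef φ)).1.apply i j).symm⟩ e.1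

theorem holeGram_mem_feasibleSet {φ : Fin n → V} (hφ : Function.Injective φ) :
    holeGram φ ∈ feasibleSet G (holeWeight G φ) :=
  ⟨holeGram_posSemidef φ, holeGram_apply_self hφ, fun _ _ _ => rfl⟩

/-- In every completion of the hole weights, the third vector is the sum of the first and the
fourth. -/
theorem mulVec_eq_zero_of_mem_feasibleSet_holeWeight (hn : 4 ≤ n)
    (φ : SimpleGraph.cycleGraph n ↪g G) {X : Matrix V V ℝ}
    (hX : X ∈ feasibleSet G (holeWeight G φ)) [DecidableEq V] :
    X *ᵥ (Pi.single (φ ⟨0, by omega⟩) 1 + Pi.single (φ ⟨3, by omega⟩) 1 -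
      Pi.single (φ ⟨2, by omega⟩) 1) = 0 := by
  have hsymm := (posSemidef_iff_isSymm.1 hX.1).1
  have hedge : ∀ i j : Fin n, (SimpleGraph.cycleGraph n).Adj i j → X (φ i) (φ j) =
      holeFst n i * holeFst n j + 3 / 4 * (holeSnd n i * holeSnd n j) := by
    intro i j hij
    rw [hX.2.2 _ _ (φ.map_adj_iff.2 hij), ← holeGram_apply φ.injective]
    rfl
  have hadj := fun i j : Fin n => cycleGraph_adj_iff_val (show 2 ≤ n by omega) i j
  have h01 : X (φ ⟨0, by omega⟩) (φ ⟨1, by omega⟩) = 1 := by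
    rw [hedge _ _ ((hadj _ _).2 (by simp))]
    norm_num [holeFst, holeSnd]
  have h12 : X (φ ⟨1, by omega⟩) (φ ⟨2, by omega⟩) = 1 / 2 := by
    rw [hedge _ _ ((hadj _ _).2 (by simp))]
    norm_num [holeFst, holeSnd]
  have h23 : X (φ ⟨2, by omega⟩) (φ ⟨3, by omega⟩) = 1 / 2 := by
    rw [hedge _ _ ((hadj _ _).2 (by simp))]
    norm_num [holeFst, holeSnd]
  have hlast : X (φ ⟨0, by omega⟩) (φ ⟨n - 1, by omega⟩) = -1 / 2 := by
    rw [hedge _ _ ((hadj _ _).2 (Or.inr (Or.inr (Or.inl ⟨rfl, Nat.sub_add_cancel (by omega)⟩))))]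
    simp [holeFst, holeSnd, show ¬ n - 1 ≤ 1 by omega, show ¬ n - 1 = 2 by omega]
  -- Vertices `3, …, n - 1` carry one common vector, so the entry at `0, 3` can be read off the
  -- closing edge between `0` and `n - 1`.
  have hchain : ∀ k (hk : k + 3 < n) x, X x (φ ⟨3, by omega⟩) = X x (φ ⟨k + 3, hk⟩) := by
    intro k
    induction k with
    | zero => intro _ x; rfl
    | succ k ih =>
      intro hk x
      rw [ih (by omega)]
      refine apply_eq_apply_of_apply_eq_one hX.1 (hX.2.1 _) (hX.2.1 _) ?_ x
      rw [hedge _ _ ((hadj _ _).2 (Or.inl (Nat.add_right_comm k 3 1)))]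
      simp only [holeFst, holeSnd]
      rw [if_neg (by omega), if_neg (by omega), if_neg (by omega), if_neg (by omega),
        if_neg (by omega), if_neg (by omega)]
      norm_num
  have h03 : X (φ ⟨0, by omega⟩) (φ ⟨3, by omega⟩) = -1 / 2 := by
    rw [hchain (n - 4) (by omega), ← hlast]
    congr 3
    omega
  have h02 : X (φ ⟨0, by omega⟩) (φ ⟨2, by omega⟩) = 1 / 2 := by
    rw [← hsymm.apply, apply_eq_apply_of_apply_eq_one hX.1 (hX.2.1 _) (hX.2.1 _) h01,
      hsymm.apply, h12]
  -- All entries among `0, 2, 3` are now forced, and the squared length is `3 - 1 - 1 - 1 = 0`.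
  refine mulVec_eq_zero_of_dotProduct hX.1 ?_
  simp only [mulVec_sub, mulVec_add, mulVec_single_one, sub_dotProduct, add_dotProduct,
    single_one_dotProduct, Pi.sub_apply, Pi.add_apply, col_apply, hX.2.1]
  rw [hsymm.apply (φ ⟨0, _⟩) (φ ⟨3, _⟩), hsymm.apply (φ ⟨0, _⟩) (φ ⟨2, _⟩),
    hsymm.apply (φ ⟨2, _⟩) (φ ⟨3, _⟩), h03, h02, h23]
  norm_num

/-- A positive semidefinite stress matrix annihilating the completion `holeGram` vanishes on the
third vertex of the hole. -/
theorem stressMatrix_mulVec_single_eq_zero (hn : 4 ≤ n) (φ : SimpleGraph.cycleGraph n ↪g G)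
    {ω : V ⊕ G.edgeSet → ℝ} (h : ∀ x, stressMatrix G ω *ᵥ (holeGram φ *ᵥ x) = 0)
    [DecidableEq V] : stressMatrix G ω *ᵥ Pi.single (φ ⟨2, by omega⟩) 1 = 0 := by
  set Ω := stressMatrix G ω
  have hsymm : Ω.IsSymm := stressMatrix_isSymm ω
  set u : V → ℝ := Function.extend φ (holeFst n) 0 with hu
  set w : V → ℝ := Function.extend φ (holeSnd n) 0 with hw
  have hui : ∀ i, u (φ i) = holeFst n i := fun i => φ.injective.extend_apply _ _ _
  have hwi : ∀ i, w (φ i) = holeSnd n i := fun i => φ.injective.extend_apply _ _ _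
  have huo : ∀ v, (¬ ∃ i, φ i = v) → u v = 0 := fun v hv => Function.extend_apply' _ _ _ hv
  have hwo : ∀ v, (¬ ∃ i, φ i = v) → w v = 0 := fun v hv => Function.extend_apply' _ _ _ hv
  have hcol : ∀ v, holeGram φ *ᵥ Pi.single v 1 = u v • u + (3 / 4 * w v) • w +
      (if v ∈ Set.range φ then 0 else 1 : ℝ) • Pi.single v 1 := by
    classical
    intro v
    ext x
    rw [mulVec_single_one, col_apply]
    simp only [holeGram, Matrix.add_apply, Matrix.smul_apply, vecMulVec_apply, ← hu, ← hw, diagonal_apply,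
      Pi.add_apply, Pi.smul_apply, smul_eq_mul, Pi.single_apply]
    by_cases hxv : x = v
    · subst hxv
      simp
      ring
    · simp [hxv]
      ring
  have hΩu : Ω *ᵥ u = 0 := by
    have := h (Pi.single (φ ⟨0, by omega⟩) 1)
    rw [hcol, hui, hwi] at this
    simpa [holeFst, holeSnd] using this
  have hΩw : Ω *ᵥ w = 0 := by
    have := h (Pi.single (φ ⟨3, by omega⟩) 1)
    rw [hcol, hui, hwi] at this
    simpa [holeFst, holeSnd, mulVec_add, mulVec_smul, hΩu] using this
  have hΩo : ∀ v, (¬ ∃ i, φ i = v) → ∀ x, Ω x v = 0 := by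
    intro v hv x
    have := h (Pi.single v 1)
    rw [hcol, huo v hv, hwo v hv, if_neg (show v ∉ Set.range φ from hv)] at this
    simpa using congrFun this x
  have hfar : ∀ i j : Fin n, i ≠ j → ¬ (SimpleGraph.cycleGraph n).Adj i j →
      Ω (φ i) (φ j) = 0 := fun i j hij hadj =>
    stressMatrix_apply_eq_zero ω (φ.injective.ne hij) fun h' => hadj (φ.map_adj_iff.1 h')
  have hadj := fun i j : Fin n => cycleGraph_adj_iff_val (show 2 ≤ n by omega) i j
  -- In row `1` of `Ω w = 0` only vertex `2` survives: `w` vanishes at `0` and `1`, and `1` has no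
  -- other neighbour on the hole.
  have h12 : Ω (φ ⟨1, by omega⟩) (φ ⟨2, by omega⟩) = 0 := by
    have h1 : ∑ x, Ω (φ ⟨1, by omega⟩) x * w x = 0 := congrFun hΩw (φ ⟨1, by omega⟩)
    rw [Finset.sum_eq_single_of_mem (φ ⟨2, by omega⟩) (Finset.mem_univ _)] at h1
    · simpa [hwi, holeSnd] using h1
    · intro x _ hx
      by_cases hxr : ∃ i, φ i = x
      · obtain ⟨i, rfl⟩ := hxr
        by_cases hi : i.val ≤ 1
        · simp [hwi, holeSnd, hi]
        · have hi2 : i.val ≠ 2 := fun h' => hx (congrArg φ (Fin.ext h'))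
          rw [hfar, zero_mul]
          · exact fun h' => hi (by simp [← h'])
          · rw [hadj]
            simp only
            omega
      · rw [hwo x hxr, mul_zero]
  have hrow : ∀ x, x ≠ φ ⟨2, by omega⟩ ∧ x ≠ φ ⟨3, by omega⟩ → Ω (φ ⟨2, by omega⟩) x = 0 := by
    rintro x ⟨hx2, hx3⟩
    by_cases hxr : ∃ i, φ i = x
    · obtain ⟨i, rfl⟩ := hxr
      have hi2 : i.val ≠ 2 := fun h' => hx2 (congrArg φ (Fin.ext h'))
      have hi3 : i.val ≠ 3 := fun h' => hx3 (congrArg φ (Fin.ext h'))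
      by_cases hi1 : i.val = 1
      · rw [hsymm.apply, ← h12]
        congr 2
        exact Fin.ext hi1
      · refine hfar _ _ (fun h' => hi2 (by simp [← h'])) ?_
        rw [hadj]
        simp only
        omega
    · exact hΩo x hxr _
  have hne : φ ⟨2, by omega⟩ ≠ φ ⟨3, by omega⟩ := φ.injective.ne (by simp)
  have h2 : ∀ y : V → ℝ, (Ω *ᵥ y) (φ ⟨2, by omega⟩) =
      Ω (φ ⟨2, by omega⟩) (φ ⟨2, by omega⟩) * y (φ ⟨2, by omega⟩) +
      Ω (φ ⟨2, by omega⟩) (φ ⟨3, by omega⟩) * y (φ ⟨3, by omega⟩) := by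
    intro y
    exact Finset.sum_eq_add _ _ hne (fun x _ hx => by simp only [hrow x hx, zero_mul])
      (by simp) (by simp)
  -- Row `2` is supported on `2` and `3`, where `u` is `1/2, -1/2` and `w` is `1, 1`; these two
  -- independent equations make the row zero.
  have hu2 := h2 u
  have hw2 := h2 w
  rw [hΩu, hui, hui] at hu2
  rw [hΩw, hwi, hwi] at hw2
  simp only [holeFst, holeSnd, Pi.zero_apply] at hu2 hw2
  norm_num at hu2 hw2
  ext x
  rw [mulVec_single_one, col_apply, Pi.zero_apply, ← hsymm.apply]
  by_cases hx2 : x = φ ⟨2, by omega⟩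
  · rw [hx2]
    linarith
  · by_cases hx3 : x = φ ⟨3, by omega⟩
    · rw [hx3]
      linarith
    · exact hrow x ⟨hx2, hx3⟩

/-- With at most one step, the final space contains `e₂` as well as the range of `X`; equal
dimensions would put `e₂` in that range. -/
theorem isChordal_of_singularityDegree_le_one (h : singularityDegree G ≤ 1) : IsChordal G := by
  classical
  intro n hn
  by_contra hne
  obtain ⟨φ⟩ := not_isEmpty_iff.1 hne
  have hgram : holeGram φ ∈ feasibleSet G (holeWeight G φ) := holeGram_mem_feasibleSet φ.injective
  obtain ⟨k, hk, ω, hnest, hval, X, hX, hrank⟩ :=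
    singularityDegree_le_one_iff.1 h _ ⟨_, hgram⟩
  have hXF := intrinsicInterior_subset hX
  obtain ⟨N, hN, hNX, hN2⟩ : ∃ N : Submodule ℝ (V → ℝ),
      nullCone (fun j => stressMatrix G (ω j)) k = N ∧ (∀ y, X *ᵥ y ∈ N) ∧
      Pi.single (φ ⟨2, by omega⟩) 1 ∈ N := by
    obtain rfl | rfl : k = 0 ∨ k = 1 := by omega
    · exact ⟨⊤, by ext; simp [nullCone], by simp, by simp⟩
    · have hps : (stressMatrix G (ω 0)).PosSemidef := posSemidef_iff_isSymm.2
        ⟨stressMatrix_isSymm _, fun x => (hnest 0).2 x (by simp [nullCone])⟩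
      refine ⟨LinearMap.ker (stressMatrix G (ω 0)).mulVecLin, ?_, fun y => ?_, ?_⟩
      · rw [nullCone_one]
        ext x
        exact ⟨fun hx => mulVec_eq_zero_of_dotProduct hps hx, fun hx => by
          change _ ⬝ᵥ (stressMatrix G (ω 0)).mulVecLin x = 0
          rw [hx, dotProduct_zero]⟩
      · exact stressMatrix_mulVec_mulVec_eq_zero hXF hps (hval 0) y
      · exact stressMatrix_mulVec_single_eq_zero hn φ
          (stressMatrix_mulVec_mulVec_eq_zero hgram hps (hval 0))
  rw [hN, Set.finrank, Submodule.span_eq] at hrank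
  obtain ⟨y, hy⟩ := exists_mulVec_eq_of_finrank_eq hNX hrank hN2
  have hker := mulVec_eq_zero_of_mem_feasibleSet_holeWeight hn φ hXF
  -- Pairing the null vector `e₀ + e₃ - e₂` with `X y = e₂` gives `0` by symmetry of `X` but `-1` by
  -- coordinates.
  have h0 := dotProduct_mulVec_comm (posSemidef_iff_isSymm.1 hXF.1).1
    (Pi.single (φ ⟨0, by omega⟩) 1 + Pi.single (φ ⟨3, by omega⟩) 1 -
      Pi.single (φ ⟨2, by omega⟩) 1) y
  rw [hker, hy, dotProduct_zero] at h0
  simp [φ.injective.eq_iff] at h0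

end Hole

end PSDCompletion

theorem theorem4p2 {V : Type*} [Fintype V] (G : SimpleGraph V) :
    PSDCompletion.singularityDegree G ≤ 1 ↔ PSDCompletion.IsChordal G :=
  ⟨PSDCompletion.isChordal_of_singularityDegree_le_one, fun hG =>
    PSDCompletion.singularityDegree_le_one_iff.2 fun _ hc =>
      ⟨1, le_rfl, hG.exists_isFacialReduction hc⟩⟩
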